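/- Let $K\subset\mathbb{R}^n$ be a convex body, i.e. a bounded, open, convex set. Let $\psi:\mathbb{R}^n\to\mathbb{R}$ be a $C^\infty$ convex function such that $\rho_\psi:=\det\nabla^2\psi$ is positive and log-concave on $\mathbb{R}^n$ and $\nabla\psi(\mathbb{R}^n)=K$. Write $\psi_i,\psi_{ij},\psi_{ijk}$ for the partial derivatives of $\psi$, $(\psi^{ij})$ for the inverse matrix of $(\psi_{ij})$, and $\psi^*(x)=\sup_{y\in\mathbb{R}^n}[\langle x,y\rangle-\psi(y)]$ for the Legendre transform, so that $\nabla\psi^*:K\to\mathbb{R}^n$ is the inverse map of $\nabla\psi$. For $x\in K$ and $U,V\in\mathbb{R}^n$ set $$Q^*_{\psi,x}(V)=\sum_{i,j,k,\ell,m,p=1}^n V^iV^j\,\psi^{\ell m}\psi_{jkm}\psi^{kp}\psi_{i\ell p},$$ $$Q_{\psi,x}(U)=\sup\Big\{4\Big(\sum_{i,j=1}^n\psi_{ij}U^iV^j\Big)^2\;;\;V\in\mathbb{R}^n,\ Q^*_{\psi,x}(V)\le 1\Big\}\in[0,\infty],$$ where all derivatives of $\psi$ are evaluated at the point $\nabla\psi^*(x)$.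 Let $\mu$ be the measure on $\mathbb{R}^n$ with density $e^{-1}\rho_\psi$, and for functions $u,h$ on $\mathbb{R}^n$ put $$\Delta^\mu u=\sum_{i,j}\psi^{ij}u_{ij},\qquad \langle\nabla^\psi u,\nabla^\psi h\rangle=\sum_{i,j}\psi^{ij}u_ih_j,\qquad |\nabla^\psi u|^2=\langle\nabla^\psi u,\nabla^\psi u\rangle .$$ Assume that $\psi$ is regular at infinity, that is, there is a linear space $X$ of $C^\infty$ functions $u:\mathbb{R}^n\to\mathbb{R}$ such that: (a) for all $u,h\in X$, and also for all $u\in X$ and all $h:\mathbb{R}^n\to\mathbb{R}$ for which $h\circ\nabla\psi^*$ is Lipschitz on $K$, the functions $h\,\Delta^\mu u$ and $\langle\nabla^\psi u,\nabla^\psi h\rangle$ belong to $L^1(\mu)$ and $\int h\,\Delta^\mu u\,d\mu=-\int\langle\nabla^\psi u,\nabla^\psi h\rangle\,d\mu$; (b) $X$ contains the constant functions, and if $u\in X$ then $\Delta^\mu u\in X$ and $|\nabla^\psi u|^2\in X$; (c) $\{\Delta^\mu u\,;\,u\in X\}$ is dense, in the topology of $L^2(\mu)$, in $\{g\in L^2(\mu)\,;\,\int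 g\,d\mu=0\}$. Then for every Lipschitz function $f:K\to\mathbb{R}$ with $\int_K f=0$, $$\int_K f(x)^2\,dx\le\int_K Q_{\psi,x}(\nabla f(x))\,dx,$$ where $\nabla f$ exists almost everywhere in $K$, and the right-hand side may be $+\infty$. -/

import Mathlib

open scoped ContDiff Gradient ENNReal NNReal
open MeasureTheory

noncomputable section

namespace MomentMap

variable {n : ℕ}

/-- A convex body: a bounded, open, convex subset of `ℝⁿ`. -/
structure IsConvexBody (K : Set (EuclideanSpace ℝ (Fin n))) : Prop where
  bounded : Bornology.IsBounded K
  isOpen : IsOpen K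
  convex : Convex ℝ K

/-- The partial derivative `u_i = ∂u/∂x_i`, as a function on `ℝⁿ`. -/
def pd (i : Fin n) (u : EuclideanSpace ℝ (Fin n) → ℝ) : EuclideanSpace ℝ (Fin n) → ℝ :=
  fun x => fderiv ℝ u x (EuclideanSpace.single i 1)

/-- The Hessian matrix `(ψ_{ij})` at a point. -/
def hess (ψ : EuclideanSpace ℝ (Fin n) → ℝ) (x : EuclideanSpace ℝ (Fin n)) :
    Matrix (Fin n) (Fin n) ℝ :=
  Matrix.of fun i j => pd i (pd j ψ) x

/-- The third derivative `ψ_{ijk}` at a point. -/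
def third (ψ : EuclideanSpace ℝ (Fin n) → ℝ) (x : EuclideanSpace ℝ (Fin n))
    (i j k : Fin n) : ℝ :=
  pd i (pd j (pd k ψ)) x

/-- `ρ_ψ = det ∇²ψ`. -/
def rho (ψ : EuclideanSpace ℝ (Fin n) → ℝ) (x : EuclideanSpace ℝ (Fin n)) : ℝ :=
  (hess ψ x).det

/-- The smooth convex function `ψ` induces a log-concave transportation to `K`. Since `ρ_ψ` is
positive, it is log-concave, that is `ρ_ψ = exp (-H)` with `H` convex, iff `log ρ_ψ` is
concave. -/
structure InducesLogConcaveTransportation (ψ : EuclideanSpace ℝ (Fin n) → ℝ)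
    (K : Set (EuclideanSpace ℝ (Fin n))) : Prop where
  smooth : ContDiff ℝ ∞ ψ
  convex : ConvexOn ℝ Set.univ ψ
  rho_pos : ∀ x, 0 < rho ψ x
  rho_logConcave : ConcaveOn ℝ Set.univ (fun x => Real.log (rho ψ x))
  range_gradient : Set.range (∇ ψ) = K

/-- The Legendre transform `ψ^*(x) = sup_y (⟨x, y⟩ - ψ(y))`. It is only used at points `x` of the
open set `∇ψ(ℝⁿ)`, where the supremum is finite. -/
def legendre (ψ : EuclideanSpace ℝ (Fin n) → ℝ) (x : EuclideanSpace ℝ (Fin n)) : ℝ :=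
  ⨆ y : EuclideanSpace ℝ (Fin n), (inner ℝ x y - ψ y)

/-- The metric `g_ψ` at the point `y` on vectors of components `U^i`, `V^j`:
`∑_{i,j} ψ_{ij}(y) U^i V^j`. -/
def metric (ψ : EuclideanSpace ℝ (Fin n) → ℝ) (y : EuclideanSpace ℝ (Fin n))
    (U V : EuclideanSpace ℝ (Fin n)) : ℝ :=
  ∑ i, ∑ j, hess ψ y i j * U i * V j

/-- The quadratic form `Q^*_{ψ,x}`; all derivatives of `ψ` are evaluated at `∇ψ^*(x)`. -/
def Qstar (ψ : EuclideanSpace ℝ (Fin n) → ℝ) (x V : EuclideanSpace ℝ (Fin n)) : ℝ :=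
  let y := ∇ (legendre ψ) x
  ∑ i, ∑ j, ∑ k, ∑ l, ∑ m, ∑ p,
    V i * V j * (hess ψ y)⁻¹ l m * third ψ y j k m * (hess ψ y)⁻¹ k p * third ψ y i l p

/-- `Q_{ψ,x}(U) = sup { 4 (∑ ψ_{ij} U^i V^j)² ; Q^*_{ψ,x}(V) ≤ 1 }`, a value in `[0, ∞]`, with
`ψ_{ij}` evaluated at `∇ψ^*(x)`. -/
def Q (ψ : EuclideanSpace ℝ (Fin n) → ℝ) (x U : EuclideanSpace ℝ (Fin n)) : ℝ≥0∞ :=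
  ⨆ (V : EuclideanSpace ℝ (Fin n)) (_ : Qstar ψ x V ≤ 1),
    ENNReal.ofReal (4 * (metric ψ (∇ (legendre ψ) x) U V) ^ 2)

/-- The Riemannian gradient `∇^ψ u`, of components `u^j = ∑_i ψ^{ij} u_i`. -/
def riemGrad (ψ u : EuclideanSpace ℝ (Fin n) → ℝ) (x : EuclideanSpace ℝ (Fin n)) :
    EuclideanSpace ℝ (Fin n) :=
  WithLp.toLp 2 fun j => ∑ i, (hess ψ x)⁻¹ i j * pd i u x

/-- The function `⟨∇^ψ u, ∇^ψ h⟩`, the inner product being that of the metric `g_ψ`. -/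
def gradInner (ψ u h : EuclideanSpace ℝ (Fin n) → ℝ) (x : EuclideanSpace ℝ (Fin n)) : ℝ :=
  metric ψ x (riemGrad ψ u x) (riemGrad ψ h x)

/-- The Laplacian `Δ^ψ u = ∑ ψ^{ij} u_{ij}`. -/
def riemLaplacian (ψ u : EuclideanSpace ℝ (Fin n) → ℝ) (x : EuclideanSpace ℝ (Fin n)) : ℝ :=
  ∑ i, ∑ j, (hess ψ x)⁻¹ i j * hess u x i j

/-- The weighted Laplacian `Δ^μ u = Δ^ψ u - ∑ ψ^{ij} u_i φ_j`. -/
def weightedLaplacian (ψ φ u : EuclideanSpace ℝ (Fin n) → ℝ)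
    (x : EuclideanSpace ℝ (Fin n)) : ℝ :=
  riemLaplacian ψ u x - ∑ i, ∑ j, (hess ψ x)⁻¹ i j * pd i u x * pd j φ x

/-- The measure `μ` of density `exp(-φ) ρ_ψ`. All functions considered are invariant under the
action of the real torus, whose total mass is one, so that they are viewed as functions on `ℝⁿ`,
and their integrals over the complex torus are integrals over `ℝⁿ`. -/
def weightedMeasure (ψ φ : EuclideanSpace ℝ (Fin n) → ℝ) :
    Measure (EuclideanSpace ℝ (Fin n)) :=
  volume.withDensity fun x => ENNReal.ofReal (Real.exp (-φ x) * rho ψ x)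

/-- The two functions `h Δ^μ u` and `⟨∇^ψ u, ∇^ψ h⟩` are `μ`-integrable, and
`∫ h Δ^μ u dμ = - ∫ ⟨∇^ψ u, ∇^ψ h⟩ dμ`. -/
def IntegratesByParts (ψ φ u h : EuclideanSpace ℝ (Fin n) → ℝ) : Prop :=
  Integrable (fun x => h x * weightedLaplacian ψ φ u x) (weightedMeasure ψ φ) ∧
  Integrable (gradInner ψ u h) (weightedMeasure ψ φ) ∧
  ∫ x, h x * weightedLaplacian ψ φ u x ∂(weightedMeasure ψ φ) =
    - ∫ x, gradInner ψ u h x ∂(weightedMeasure ψ φ)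

/-- `X` is a linear space of smooth functions witnessing that the pair `(ψ, φ)` is regular at
infinity. By `parts` and the closure properties, each `Δ^μ u` with `u ∈ X` lies in `L²(μ)` and has
zero `μ`-integral; `dense` says that these functions are dense among all such functions. -/
structure IsRegularitySpace (ψ φ : EuclideanSpace ℝ (Fin n) → ℝ)
    (X : Submodule ℝ (EuclideanSpace ℝ (Fin n) → ℝ)) : Prop where
  smooth : ∀ u ∈ X, ContDiff ℝ ∞ u
  parts : ∀ u ∈ X, ∀ h ∈ X, IntegratesByParts ψ φ u h
  parts_lipschitz : ∀ u ∈ X, ∀ h : EuclideanSpace ℝ (Fin n) → ℝ,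
    (∃ C : ℝ≥0, LipschitzOnWith C (fun x => h (∇ (legendre ψ) x)) (Set.range (∇ ψ))) →
      IntegratesByParts ψ φ u h
  const_mem : ∀ c : ℝ, (fun _ => c) ∈ X
  laplacian_mem : ∀ u ∈ X, weightedLaplacian ψ φ u ∈ X
  normSq_mem : ∀ u ∈ X, gradInner ψ u u ∈ X
  dense : ∀ g : EuclideanSpace ℝ (Fin n) → ℝ, MemLp g 2 (weightedMeasure ψ φ) →
    ∫ x, g x ∂(weightedMeasure ψ φ) = 0 → ∀ ε : ℝ≥0∞, 0 < ε →
      ∃ u ∈ X, eLpNorm (g - weightedLaplacian ψ φ u) 2 (weightedMeasure ψ φ) < ε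

/-- The pair `(ψ, φ)` is regular at infinity. -/
def PairRegularAtInfinity (ψ φ : EuclideanSpace ℝ (Fin n) → ℝ) : Prop :=
  ∃ X : Submodule ℝ (EuclideanSpace ℝ (Fin n) → ℝ), IsRegularitySpace ψ φ X

/-- `ψ` is regular at infinity when the pair `(ψ, 1)` is. -/
def RegularAtInfinity (ψ : EuclideanSpace ℝ (Fin n) → ℝ) : Prop :=
  PairRegularAtInfinity ψ (fun _ => 1)

end MomentMap

end

noncomputable section

namespace MomentMap

variable {n : ℕ}

/-! ### Calculus of partial derivatives -/

section PartialDerivatives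

variable {u h : EuclideanSpace ℝ (Fin n) → ℝ} {x : EuclideanSpace ℝ (Fin n)}

/-! The argument is a dual (Hörmander-type) form of Bochner's method for the Hessian metric `g_ψ`.
Put `h = f ∘ ∇ψ` and `L = Δ^μ`. The map `∇ψ` carries `μ` to `e⁻¹` times Lebesgue measure on `K`
(`map_gradient_weightedMeasure`), so both sides can be compared as integrals against `μ`. For `u ∈
X`, `∫ h² = ∫ (h - Lu)² + 2 ∫ h Lu - ∫ (Lu)²`, and the first term on the right is arbitrarily small
by density. It remains to show `2 ∫ h Lu ≤ ∫ Q(∇f) + ∫ (Lu)²`.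

Integration by parts turns `∫ h Lu` into `-∫ ⟨∇^ψ u, ∇^ψ h⟩`. By the chain rule this integrand is
`g_ψ(∇f, ∇^ψ u)`, with `∇f` taken at `∇ψ` (`gradInner_comp_gradient`). Duality of `Q` and `Q^*`
bounds twice its absolute value by `Q(∇f) + Q^*(∇^ψ u) / 4` (`two_mul_abs_metric_le`).

The curvature input is `bochner_inequality`: `Q^*(∇^ψ u) ≤ 2 (L|∇^ψ u|² - 2⟨∇^ψ u, ∇^ψ Lu⟩)`, where
log-concavity of `ρ_ψ` gives the Ricci term its sign. The bracket integrates to `2 ∫ (Lu)²`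
(`IsRegularitySpace.integral_bochner`), so `∫ Q^*(∇^ψ u) / 4 ≤ ∫ (Lu)²`, exactly what is needed. -/

lemma contDiff_pd (i : Fin n) (hu : ContDiff ℝ ∞ u) : ContDiff ℝ ∞ (pd i u) :=
  (hu.fderiv_right (m := ∞) (by simp)).clm_apply contDiff_const

lemma differentiableAt_of_smooth (hu : ContDiff ℝ ∞ u) : DifferentiableAt ℝ u x :=
  (hu.differentiable (by simp)).differentiableAt

lemma pd_comm (i j : Fin n) (hu : ContDiff ℝ ∞ u) : pd i (pd j u) = pd j (pd i u) := by
  funext x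
  have hd : DifferentiableAt ℝ (fderiv ℝ u) x :=
    ((hu.fderiv_right (m := ∞) (by simp)).differentiable (by simp)).differentiableAt
  have hs : IsSymmSndFDerivAt ℝ u x :=
    (contDiff_infty.1 hu 2).contDiffAt.isSymmSndFDerivAt (by simp)
  have key : ∀ i j : Fin n, pd i (pd j u) x =
      fderiv ℝ (fderiv ℝ u) x (EuclideanSpace.single i 1) (EuclideanSpace.single j 1) := by
    intro i j
    change fderiv ℝ (fun y => fderiv ℝ u y (EuclideanSpace.single j 1)) x _ = _
    rw [fderiv_clm_apply hd (differentiableAt_const _)]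
    simp
  rw [key, key, hs.eq]

lemma pd_const (i : Fin n) (c : ℝ) : pd i (fun _ : EuclideanSpace ℝ (Fin n) => c) = 0 := by
  funext x
  simp [pd]

lemma pd_sub (k : Fin n) (hu : DifferentiableAt ℝ u x) (hh : DifferentiableAt ℝ h x) :
    pd k (fun y => u y - h y) x = pd k u x - pd k h x := by
  simp [pd, fderiv_fun_sub hu hh]

lemma pd_const_mul (k : Fin n) (c : ℝ) (hu : DifferentiableAt ℝ u x) :
    pd k (fun y => c * u y) x = c * pd k u x := by
  simp [pd, fderiv_const_mul hu]

lemma pd_mul (k : Fin n) (hu : DifferentiableAt ℝ u x) (hh : DifferentiableAt ℝ h x) :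
    pd k (fun y => u y * h y) x = pd k u x * h x + u x * pd k h x := by
  simp [pd, fderiv_fun_mul hu hh]; ring

lemma pd_sum {ι : Type*} (s : Finset ι) (k : Fin n) {v : ι → EuclideanSpace ℝ (Fin n) → ℝ}
    (hv : ∀ i ∈ s, DifferentiableAt ℝ (v i) x) :
    pd k (fun y => ∑ i ∈ s, v i y) x = ∑ i ∈ s, pd k (v i) x := by
  simp [pd, fderiv_fun_sum hv]

lemma fderiv_apply_eq_sum_pd (u : EuclideanSpace ℝ (Fin n) → ℝ) (x v : EuclideanSpace ℝ (Fin n)) :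
    fderiv ℝ u x v = ∑ i, v i * pd i u x := by
  have hv : v = ∑ i, v i • EuclideanSpace.single i (1 : ℝ) := by
    ext j
    simp [Pi.single_apply]
  conv_lhs => rw [hv]
  simp [pd]

end PartialDerivatives

/-! ### Smooth vector-valued and matrix-valued functions -/

section MatrixFunctions

open Matrix

variable {ι κ τ : Type*} [Fintype ι] [Fintype κ]
  {w v : EuclideanSpace ℝ (Fin n) → ι → ℝ}
  {M : EuclideanSpace ℝ (Fin n) → Matrix τ ι ℝ} {N : EuclideanSpace ℝ (Fin n) → Matrix ι κ ℝ}

/-- The partial derivative of a vector field. -/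
def pdVec (k : Fin n) (w : EuclideanSpace ℝ (Fin n) → ι → ℝ) (x : EuclideanSpace ℝ (Fin n)) :
    ι → ℝ :=
  fun i => pd k (fun y => w y i) x

/-- The partial derivative of a matrix field. -/
def pdMat {ι κ : Type*} (k : Fin n) (M : EuclideanSpace ℝ (Fin n) → Matrix ι κ ℝ)
    (x : EuclideanSpace ℝ (Fin n)) : Matrix ι κ ℝ :=
  Matrix.of fun i j => pd k (fun y => M y i j) x

/-- A vector field with smooth components. -/
def SmoothVec {ι : Type*} (w : EuclideanSpace ℝ (Fin n) → ι → ℝ) : Prop :=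
  ∀ i, ContDiff ℝ ∞ fun x => w x i

/-- A matrix field with smooth entries. -/
def SmoothMat {ι κ : Type*} (M : EuclideanSpace ℝ (Fin n) → Matrix ι κ ℝ) : Prop :=
  ∀ i j, ContDiff ℝ ∞ fun x => M x i j

lemma SmoothVec.dotProduct (hw : SmoothVec w) (hv : SmoothVec v) :
    ContDiff ℝ ∞ fun x => w x ⬝ᵥ v x :=
  ContDiff.sum fun i _ => (hw i).mul (hv i)

lemma SmoothMat.mulVec (hM : SmoothMat M) (hv : SmoothVec v) :
    SmoothVec fun x => M x *ᵥ v x :=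
  fun i => ContDiff.sum fun j _ => (hM i j).mul (hv j)

omit [Fintype κ] in
lemma SmoothMat.mul (hM : SmoothMat M) (hN : SmoothMat N) : SmoothMat fun x => M x * N x :=
  fun i k => by
    simp only [Matrix.mul_apply]
    exact ContDiff.sum fun j _ => (hM i j).mul (hN j k)

lemma SmoothMat.trace {M : EuclideanSpace ℝ (Fin n) → Matrix ι ι ℝ} (hM : SmoothMat M) :
    ContDiff ℝ ∞ fun x => (M x).trace :=
  ContDiff.sum fun i _ => hM i i

lemma pd_dotProduct (k : Fin n) (hw : SmoothVec w) (hv : SmoothVec v)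
    (x : EuclideanSpace ℝ (Fin n)) :
    pd k (fun y => w y ⬝ᵥ v y) x = pdVec k w x ⬝ᵥ v x + w x ⬝ᵥ pdVec k v x := by
  simp only [_root_.dotProduct, pdVec]
  rw [pd_sum _ _ fun i _ => differentiableAt_of_smooth ((hw i).mul (hv i)),
    ← Finset.sum_add_distrib]
  exact Finset.sum_congr rfl fun i _ =>
    pd_mul k (differentiableAt_of_smooth (hw i)) (differentiableAt_of_smooth (hv i))

lemma pdVec_mulVec (k : Fin n) (hM : SmoothMat M) (hv : SmoothVec v)
    (x : EuclideanSpace ℝ (Fin n)) :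
    pdVec k (fun y => M y *ᵥ v y) x = pdMat k M x *ᵥ v x + M x *ᵥ pdVec k v x := by
  funext i
  exact pd_dotProduct k (w := fun y => M y i) (hM i) hv x

omit [Fintype κ] in
lemma pdMat_mul (k : Fin n) (hM : SmoothMat M) (hN : SmoothMat N)
    (x : EuclideanSpace ℝ (Fin n)) :
    pdMat k (fun y => M y * N y) x = pdMat k M x * N x + M x * pdMat k N x := by
  ext i j
  exact pd_dotProduct k (w := fun y => M y i) (v := fun y l => N y l j) (hM i)
    (fun l => hN l j) x

lemma pd_trace (k : Fin n) {M : EuclideanSpace ℝ (Fin n) → Matrix ι ι ℝ} (hM : SmoothMat M)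
    (x : EuclideanSpace ℝ (Fin n)) :
    pd k (fun y => (M y).trace) x = (pdMat k M x).trace :=
  pd_sum _ _ fun i _ => differentiableAt_of_smooth (hM i i)

variable [DecidableEq ι]

lemma SmoothMat.det {M : EuclideanSpace ℝ (Fin n) → Matrix ι ι ℝ} (hM : SmoothMat M) :
    ContDiff ℝ ∞ fun x => (M x).det := by
  simp only [Matrix.det_apply']
  exact ContDiff.sum fun σ _ => contDiff_const.mul (contDiff_prod fun i _ => hM _ _)

lemma SmoothMat.adjugate {M : EuclideanSpace ℝ (Fin n) → Matrix ι ι ℝ} (hM : SmoothMat M) :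
    SmoothMat fun x => (M x).adjugate := by
  intro i j
  simp only [Matrix.adjugate_apply]
  refine SmoothMat.det (M := fun x => (M x).updateRow j (Pi.single i 1)) fun a b => ?_
  by_cases h : a = j
  · subst h
    simpa using contDiff_const
  · simpa [Matrix.updateRow_apply, h] using hM a b

lemma SmoothMat.inv {M : EuclideanSpace ℝ (Fin n) → Matrix ι ι ℝ} (hM : SmoothMat M)
    (h0 : ∀ x, (M x).det ≠ 0) : SmoothMat fun x => (M x)⁻¹ := by
  intro i j
  simp only [Matrix.inv_def, Ring.inverse_eq_inv', Matrix.smul_apply, smul_eq_mul]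
  exact (hM.det.inv h0).mul (hM.adjugate i j)

lemma pdMat_inv (k : Fin n) {M : EuclideanSpace ℝ (Fin n) → Matrix ι ι ℝ} (hM : SmoothMat M)
    (h0 : ∀ x, (M x).det ≠ 0) (x : EuclideanSpace ℝ (Fin n)) :
    pdMat k (fun y => (M y)⁻¹) x = -((M x)⁻¹ * pdMat k M x * (M x)⁻¹) := by
  have h1 : pdMat k (fun y => M y * (M y)⁻¹) x = 0 := by
    have : (fun y => M y * (M y)⁻¹) = fun _ => 1 := by
      funext y
      exact Matrix.mul_nonsing_inv _ (isUnit_iff_ne_zero.2 (h0 y))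
    rw [this]
    ext i j
    simp [pdMat, pd_const]
  rw [pdMat_mul k hM (hM.inv h0)] at h1
  have h2 := congrArg (fun P => (M x)⁻¹ * P) h1
  simp only [mul_add, mul_zero, ← mul_assoc] at h2
  rw [Matrix.nonsing_inv_mul _ (isUnit_iff_ne_zero.2 (h0 x)), one_mul] at h2
  exact eq_neg_of_add_eq_zero_right h2

/-- Jacobi's formula. -/
lemma pd_det (k : Fin n) {M : EuclideanSpace ℝ (Fin n) → Matrix ι ι ℝ} (hM : SmoothMat M)
    (x : EuclideanSpace ℝ (Fin n)) :
    pd k (fun y => (M y).det) x = ((M x).adjugate * pdMat k M x).trace := by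
  have hd : ∀ i j, DifferentiableAt ℝ (fun y => M y i j) x :=
    fun i j => differentiableAt_of_smooth (hM i j)
  have h1 : ∀ σ : Equiv.Perm ι, pd k (fun y => ((σ.sign : ℤ) : ℝ) * ∏ i, M y (σ i) i) x =
      ∑ i, ((σ.sign : ℤ) : ℝ) *
        ((∏ j ∈ Finset.univ.erase i, M x (σ j) j) * pd k (fun y => M y (σ i) i) x) := by
    intro σ
    rw [pd_const_mul _ _ (differentiableAt_of_smooth (contDiff_prod fun i _ => hM _ _)),
      ← Finset.mul_sum]
    congr 1
    have := HasFDerivAt.finsetProd (u := Finset.univ) (g := fun i y => M y (σ i) i)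
      (fun i _ => (hd (σ i) i).hasFDerivAt)
    simp only [pd, this.fderiv]
    simp
  -- Cramer's rule: each diagonal entry is the determinant with one column differentiated, which
  -- matches the product rule applied to the Leibniz expansion.
  have h2 : ∀ i, ((M x).adjugate * pdMat k M x) i i =
      ((M x).updateCol i fun r => pd k (fun y => M y r i) x).det := by
    intro i
    rw [← Matrix.cramer_apply, Matrix.cramer_eq_adjugate_mulVec]
    rfl
  simp only [Matrix.det_apply', Matrix.trace, Matrix.diag_apply, h2]
  rw [pd_sum _ _ fun σ _ => differentiableAt_of_smooth
    (contDiff_const.mul (contDiff_prod fun i _ => hM _ _)), Finset.sum_comm]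
  refine Finset.sum_congr rfl fun σ _ => ?_
  rw [h1]
  refine Finset.sum_congr rfl fun i _ => ?_
  rw [← Finset.prod_erase_mul _ _ (Finset.mem_univ i)]
  congr 2
  · refine Finset.prod_congr rfl fun j hj => ?_
    rw [Matrix.updateCol_ne (Finset.ne_of_mem_erase hj)]
  · simp

lemma pd_log_det (k : Fin n) {M : EuclideanSpace ℝ (Fin n) → Matrix ι ι ℝ} (hM : SmoothMat M)
    (h0 : ∀ x, (M x).det ≠ 0) (x : EuclideanSpace ℝ (Fin n)) :
    pd k (fun y => Real.log (M y).det) x = ((M x)⁻¹ * pdMat k M x).trace := by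
  have := (differentiableAt_of_smooth (x := x) hM.det).hasFDerivAt.log (h0 x)
  have h2 : pd k (fun y => Real.log (M y).det) x =
      ((M x).det)⁻¹ * pd k (fun y => (M y).det) x := by
    simp [pd, this.fderiv]
  rw [h2, pd_det k hM, Matrix.inv_def, Ring.inverse_eq_inv', Matrix.smul_mul, Matrix.trace_smul,
    smul_eq_mul]

end MatrixFunctions

/-! ### The Bochner inequality -/

section Bochner

open Matrix

variable {ψ u h : EuclideanSpace ℝ (Fin n) → ℝ}

/-- The vector of partial derivatives. -/
def gradVec (u : EuclideanSpace ℝ (Fin n) → ℝ) (x : EuclideanSpace ℝ (Fin n)) : Fin n → ℝ :=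
  fun i => pd i u x

/-- The components of `∇^ψ u`, in matrix form. -/
def riemVec (ψ u : EuclideanSpace ℝ (Fin n) → ℝ) (x : EuclideanSpace ℝ (Fin n)) : Fin n → ℝ :=
  (hess ψ x)⁻¹ *ᵥ gradVec u x

/-- The contraction `∑ₖ Vᵏ ψ_{ijk}` of the third derivative with a vector. -/
def thirdContract (ψ : EuclideanSpace ℝ (Fin n) → ℝ) (x : EuclideanSpace ℝ (Fin n))
    (V : Fin n → ℝ) : Matrix (Fin n) (Fin n) ℝ :=
  Matrix.of fun i => pdMat i (hess ψ) x *ᵥ V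

lemma smoothVec_gradVec (hu : ContDiff ℝ ∞ u) : SmoothVec (gradVec u) :=
  fun i => contDiff_pd i hu

lemma smoothMat_hess (hu : ContDiff ℝ ∞ u) : SmoothMat (hess u) :=
  fun i j => contDiff_pd i (contDiff_pd j hu)

lemma smoothMat_pdMat {M : EuclideanSpace ℝ (Fin n) → Matrix (Fin n) (Fin n) ℝ} (k : Fin n)
    (hM : SmoothMat M) : SmoothMat (pdMat k M) :=
  fun i j => contDiff_pd k (hM i j)

lemma hess_transpose (hu : ContDiff ℝ ∞ u) (x : EuclideanSpace ℝ (Fin n)) :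
    (hess u x)ᵀ = hess u x := by
  ext i j
  exact congrFun (pd_comm j i hu) x

lemma pdMat_hess_transpose (k : Fin n) (hu : ContDiff ℝ ∞ u) (x : EuclideanSpace ℝ (Fin n)) :
    (pdMat k (hess u) x)ᵀ = pdMat k (hess u) x := by
  ext i j
  exact congrFun (congrArg (pd k) (pd_comm j i hu)) x

lemma pdMat_hess_left_comm (k i j : Fin n) (hu : ContDiff ℝ ∞ u)
    (x : EuclideanSpace ℝ (Fin n)) :
    pdMat k (hess u) x i j = pdMat i (hess u) x k j :=
  congrFun (pd_comm k i (contDiff_pd j hu)) x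

lemma thirdContract_eq_sum (hψ : ContDiff ℝ ∞ ψ) (x : EuclideanSpace ℝ (Fin n))
    (V : Fin n → ℝ) : thirdContract ψ x V = ∑ k, V k • pdMat k (hess ψ) x := by
  ext i j
  simp only [thirdContract, Matrix.of_apply, Matrix.mulVec, dotProduct, Matrix.sum_apply,
    Matrix.smul_apply, smul_eq_mul]
  refine Finset.sum_congr rfl fun k _ => ?_
  rw [mul_comm, pdMat_hess_left_comm k i j hψ]
  congr 1
  exact congrFun (congrFun (pdMat_hess_transpose i hψ x) k) j

lemma thirdContract_transpose (hψ : ContDiff ℝ ∞ ψ) (x : EuclideanSpace ℝ (Fin n))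
    (V : Fin n → ℝ) : (thirdContract ψ x V)ᵀ = thirdContract ψ x V := by
  simp [thirdContract_eq_sum hψ, Matrix.transpose_sum, pdMat_hess_transpose _ hψ]

lemma hess_inv_transpose (hψ : ContDiff ℝ ∞ ψ) (x : EuclideanSpace ℝ (Fin n)) :
    ((hess ψ x)⁻¹)ᵀ = (hess ψ x)⁻¹ := by
  rw [Matrix.transpose_nonsing_inv, hess_transpose hψ]

lemma riemGrad_eq (hψ : ContDiff ℝ ∞ ψ) (u : EuclideanSpace ℝ (Fin n) → ℝ)
    (x : EuclideanSpace ℝ (Fin n)) : riemGrad ψ u x = WithLp.toLp 2 (riemVec ψ u x) := by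
  ext j
  simp only [riemGrad, riemVec, Matrix.mulVec, dotProduct, gradVec]
  refine Finset.sum_congr rfl fun i _ => ?_
  congr 1
  exact congrFun (congrFun (hess_inv_transpose hψ x) j) i

lemma metric_eq (ψ : EuclideanSpace ℝ (Fin n) → ℝ) (x U V : EuclideanSpace ℝ (Fin n)) :
    metric ψ x U V = U.ofLp ⬝ᵥ (hess ψ x *ᵥ V.ofLp) := by
  simp only [metric, Matrix.mulVec, dotProduct, Finset.mul_sum]
  exact Finset.sum_congr rfl fun i _ => Finset.sum_congr rfl fun j _ => by ring

lemma hess_mulVec_riemVec (hdet : ∀ x, (hess ψ x).det ≠ 0) (u : EuclideanSpace ℝ (Fin n) → ℝ)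
    (x : EuclideanSpace ℝ (Fin n)) : hess ψ x *ᵥ riemVec ψ u x = gradVec u x := by
  rw [riemVec, Matrix.mulVec_mulVec, Matrix.mul_nonsing_inv _ (isUnit_iff_ne_zero.2 (hdet x)),
    Matrix.one_mulVec]

lemma gradInner_eq (hψ : ContDiff ℝ ∞ ψ) (hdet : ∀ x, (hess ψ x).det ≠ 0)
    (u h : EuclideanSpace ℝ (Fin n) → ℝ) (x : EuclideanSpace ℝ (Fin n)) :
    gradInner ψ u h x = riemVec ψ u x ⬝ᵥ gradVec h x := by
  rw [gradInner, metric_eq, riemGrad_eq hψ, riemGrad_eq hψ, hess_mulVec_riemVec hdet]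

lemma weightedLaplacian_eq (c : ℝ) (hu : ContDiff ℝ ∞ u) (x : EuclideanSpace ℝ (Fin n)) :
    weightedLaplacian ψ (fun _ => c) u x = ((hess ψ x)⁻¹ * hess u x).trace := by
  have h1 : weightedLaplacian ψ (fun _ => c) u x = riemLaplacian ψ u x := by
    simp [weightedLaplacian, pd_const]
  rw [h1]
  simp only [riemLaplacian, Matrix.trace, Matrix.diag_apply, Matrix.mul_apply]
  refine Finset.sum_congr rfl fun i _ => Finset.sum_congr rfl fun j _ => ?_
  congr 1
  exact congrFun (pd_comm i j hu) x

/-- The trace form reduces sign questions to positivity of `tr(GPGP)`, and is the form in which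
`Q^*` appears in the Bochner computation. -/
lemma Qstar_eq (hψ : ContDiff ℝ ∞ ψ) (x V : EuclideanSpace ℝ (Fin n)) :
    Qstar ψ x V = ((hess ψ (∇ (legendre ψ) x))⁻¹ * thirdContract ψ (∇ (legendre ψ) x) V *
      (hess ψ (∇ (legendre ψ) x))⁻¹ * thirdContract ψ (∇ (legendre ψ) x) V).trace := by
  set y := ∇ (legendre ψ) x
  set G := (hess ψ y)⁻¹
  have h1 : Qstar ψ x V = ∑ k, ∑ l, ∑ m, ∑ p,
      G l m * (∑ j, V j * third ψ y j k m) * G k p * (∑ i, V i * third ψ y i l p) := by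
    simp only [Qstar, Finset.mul_sum, Finset.sum_mul]
    rw [Finset.sum_comm]
    have e1 : ∀ f : Fin n → Fin n → Fin n → Fin n → Fin n → Fin n → ℝ,
        ∑ j, ∑ i, ∑ k, ∑ l, ∑ m, ∑ p, f i j k l m p =
          ∑ k, ∑ l, ∑ m, ∑ p, ∑ i, ∑ j, f i j k l m p := by
      intro f
      simp only [← Finset.sum_product', Finset.univ_product_univ]
      refine Fintype.sum_equiv
        ⟨fun t => (t.2.2.1, t.2.2.2.1, t.2.2.2.2.1, t.2.2.2.2.2, t.2.1, t.1),
          fun t => (t.2.2.2.2.2, t.2.2.2.2.1, t.1, t.2.1, t.2.2.1, t.2.2.2.1),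
          fun _ => rfl, fun _ => rfl⟩ _ _ fun _ => rfl
    rw [e1]
    refine Finset.sum_congr rfl fun k _ => Finset.sum_congr rfl fun l _ =>
      Finset.sum_congr rfl fun m _ => Finset.sum_congr rfl fun p _ =>
      Finset.sum_congr rfl fun i _ => Finset.sum_congr rfl fun j _ => ?_
    change V i * V j * G l m * _ * G k p * _ = _
    ring
  have h2 : ∀ k m, ∑ j, V j * third ψ y j k m = thirdContract ψ y V k m := by
    intro k m
    rw [thirdContract_eq_sum hψ, Matrix.sum_apply]
    rfl
  have h3 : ∀ k m, thirdContract ψ y V k m = thirdContract ψ y V m k := fun k m =>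
    congrFun (congrFun (thirdContract_transpose hψ y V) m) k
  simp only [h1, h2, Matrix.trace, Matrix.diag_apply, Matrix.mul_apply, Finset.sum_mul]
  rw [Finset.sum_comm]
  refine Finset.sum_congr rfl fun l _ => ?_
  have e2 : ∀ f : Fin n → Fin n → Fin n → ℝ,
      ∑ p, ∑ k, ∑ m, f k m p = ∑ k, ∑ m, ∑ p, f k m p := by
    intro f
    rw [Finset.sum_comm]
    exact Finset.sum_congr rfl fun k _ => Finset.sum_comm
  conv_rhs => rw [e2]
  refine Finset.sum_congr rfl fun k _ => Finset.sum_congr rfl fun m _ =>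
    Finset.sum_congr rfl fun p _ => ?_
  rw [h3 k m, h3 l p]

lemma smoothMat_hess_inv (hψ : ContDiff ℝ ∞ ψ) (hdet : ∀ x, (hess ψ x).det ≠ 0) :
    SmoothMat fun x => (hess ψ x)⁻¹ :=
  (smoothMat_hess hψ).inv hdet

lemma smoothVec_riemVec (hψ : ContDiff ℝ ∞ ψ) (hdet : ∀ x, (hess ψ x).det ≠ 0)
    (hu : ContDiff ℝ ∞ u) : SmoothVec (riemVec ψ u) :=
  (smoothMat_hess_inv hψ hdet).mulVec (smoothVec_gradVec hu)

lemma pdVec_riemVec (k : Fin n) (hψ : ContDiff ℝ ∞ ψ) (hdet : ∀ x, (hess ψ x).det ≠ 0)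
    (hu : ContDiff ℝ ∞ u) (x : EuclideanSpace ℝ (Fin n)) :
    pdVec k (riemVec ψ u) x =
      (hess ψ x)⁻¹ *ᵥ (hess u x k - pdMat k (hess ψ) x *ᵥ riemVec ψ u x) := by
  have h1 : pdVec k (riemVec ψ u) x =
      pdMat k (fun y => (hess ψ y)⁻¹) x *ᵥ gradVec u x + (hess ψ x)⁻¹ *ᵥ pdVec k (gradVec u) x :=
    pdVec_mulVec k (smoothMat_hess_inv hψ hdet) (smoothVec_gradVec hu) x
  rw [h1, pdMat_inv k (smoothMat_hess hψ) hdet, Matrix.mulVec_sub, Matrix.neg_mulVec,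
    neg_add_eq_sub]
  simp only [riemVec, Matrix.mulVec_mulVec, mul_assoc]
  rfl

lemma dotProduct_mulVec_comm {M : Matrix (Fin n) (Fin n) ℝ} (hM : Mᵀ = M) (a b : Fin n → ℝ) :
    a ⬝ᵥ M *ᵥ b = b ⬝ᵥ M *ᵥ a := by
  rw [Matrix.dotProduct_mulVec, ← Matrix.mulVec_transpose, hM, dotProduct_comm]

lemma pd_gradInner_self (l : Fin n) (hψ : ContDiff ℝ ∞ ψ) (hdet : ∀ x, (hess ψ x).det ≠ 0)
    (hu : ContDiff ℝ ∞ u) :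
    pd l (gradInner ψ u u) = fun x => 2 * (hess u x l ⬝ᵥ riemVec ψ u x) -
      riemVec ψ u x ⬝ᵥ pdMat l (hess ψ) x *ᵥ riemVec ψ u x := by
  have h0 : gradInner ψ u u = fun x => riemVec ψ u x ⬝ᵥ gradVec u x :=
    funext (gradInner_eq hψ hdet u u)
  funext x
  rw [h0, pd_dotProduct l (smoothVec_riemVec hψ hdet hu) (smoothVec_gradVec hu),
    pdVec_riemVec l hψ hdet hu, dotProduct_comm, dotProduct_mulVec_comm (hess_inv_transpose hψ x)]
  change (_ - _) ⬝ᵥ riemVec ψ u x + riemVec ψ u x ⬝ᵥ hess u x l = _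
  rw [sub_dotProduct, dotProduct_comm (riemVec ψ u x) (hess u x l),
    dotProduct_comm (pdMat l (hess ψ) x *ᵥ riemVec ψ u x)]
  ring

/-- With `V = ∇^ψ u`, one has `∂ₖV = (∇²ψ)⁻¹(A - B)ₖ`, where `A` is the Hessian of `u` and `B`
contracts `∇³ψ` with `V`. Grouping the second-order terms through this identity produces a quadratic
expression in `A - B`. -/
lemma pd_pd_gradInner_self (k l : Fin n) (hψ : ContDiff ℝ ∞ ψ)
    (hdet : ∀ x, (hess ψ x).det ≠ 0) (hu : ContDiff ℝ ∞ u) (x : EuclideanSpace ℝ (Fin n)) :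
    pd k (pd l (gradInner ψ u u)) x = 2 * (pdMat k (hess u) x l ⬝ᵥ riemVec ψ u x) +
      2 * ((hess u x - thirdContract ψ x (riemVec ψ u x)) l ⬝ᵥ
        (hess ψ x)⁻¹ *ᵥ (hess u x - thirdContract ψ x (riemVec ψ u x)) k) -
      riemVec ψ u x ⬝ᵥ pdMat k (pdMat l (hess ψ)) x *ᵥ riemVec ψ u x := by
  have hv := smoothVec_riemVec hψ hdet hu
  have hT := smoothMat_pdMat l (smoothMat_hess hψ)
  have hA : SmoothVec fun y => hess u y l := smoothMat_hess hu l
  rw [pd_gradInner_self l hψ hdet hu, pd_sub k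
    (differentiableAt_of_smooth (contDiff_const.mul (hA.dotProduct hv)))
    (differentiableAt_of_smooth (hv.dotProduct (hT.mulVec hv))),
    pd_const_mul k 2 (differentiableAt_of_smooth (hA.dotProduct hv)), pd_dotProduct k hA hv,
    pd_dotProduct k hv (hT.mulVec hv), pdVec_mulVec k hT hv, dotProduct_add,
    dotProduct_mulVec_comm (pdMat_hess_transpose l hψ x) (riemVec ψ u x)]
  have e : pdVec k (riemVec ψ u) x =
      (hess ψ x)⁻¹ *ᵥ (hess u x - thirdContract ψ x (riemVec ψ u x)) k :=
    pdVec_riemVec k hψ hdet hu x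
  rw [← e]
  change 2 * (pdMat k (hess u) x l ⬝ᵥ _ + _) - _ = _ + 2 * ((hess u x l -
    pdMat l (hess ψ) x *ᵥ riemVec ψ u x) ⬝ᵥ _) - _
  rw [sub_dotProduct, dotProduct_comm (pdMat l (hess ψ) x *ᵥ riemVec ψ u x)]
  ring

lemma sum_mul_dotProduct_mulVec (G P : Matrix (Fin n) (Fin n) ℝ) (hP : Pᵀ = P) :
    ∑ k, ∑ l, G k l * (P l ⬝ᵥ G *ᵥ P k) = (G * P * G * P).trace := by
  rw [mul_assoc, mul_assoc]
  simp only [Matrix.trace, Matrix.diag_apply]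
  refine Finset.sum_congr rfl fun k _ => ?_
  rw [Matrix.mul_apply]
  refine Finset.sum_congr rfl fun l _ => ?_
  congr 1
  rw [Matrix.mul_apply]
  refine Finset.sum_congr rfl fun i _ => ?_
  congr 1
  change ∑ j, G i j * Pᵀ j k = _
  rw [hP, Matrix.mul_apply]

lemma weightedLaplacian_gradInner_self (c : ℝ) (hψ : ContDiff ℝ ∞ ψ)
    (hdet : ∀ x, (hess ψ x).det ≠ 0) (hu : ContDiff ℝ ∞ u)
    (x : EuclideanSpace ℝ (Fin n)) :
    weightedLaplacian ψ (fun _ => c) (gradInner ψ u u) x =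
      2 * (∑ k, ∑ l, (hess ψ x)⁻¹ k l * (pdMat k (hess u) x l ⬝ᵥ riemVec ψ u x)) +
      2 * ((hess ψ x)⁻¹ * (hess u x - thirdContract ψ x (riemVec ψ u x)) * (hess ψ x)⁻¹ *
        (hess u x - thirdContract ψ x (riemVec ψ u x))).trace -
      ∑ k, ∑ l, (hess ψ x)⁻¹ k l *
        (riemVec ψ u x ⬝ᵥ pdMat k (pdMat l (hess ψ)) x *ᵥ riemVec ψ u x) := by
  have hsymm : (hess u x - thirdContract ψ x (riemVec ψ u x))ᵀ =
      hess u x - thirdContract ψ x (riemVec ψ u x) := by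
    rw [Matrix.transpose_sub, hess_transpose hu, thirdContract_transpose hψ]
  have h1 : weightedLaplacian ψ (fun _ => c) (gradInner ψ u u) x =
      ∑ k, ∑ l, (hess ψ x)⁻¹ k l * pd k (pd l (gradInner ψ u u)) x := by
    simp [weightedLaplacian, pd_const, riemLaplacian, hess]
  rw [h1, ← sum_mul_dotProduct_mulVec _ _ hsymm]
  simp only [pd_pd_gradInner_self _ _ hψ hdet hu, Finset.mul_sum, ← Finset.sum_add_distrib,
    ← Finset.sum_sub_distrib]
  exact Finset.sum_congr rfl fun k _ => Finset.sum_congr rfl fun l _ => by ring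

/-- The sum containing third derivatives of `u` is the one occurring in
`weightedLaplacian_gradInner_self`, so it cancels in the Bochner combination. The trace comes from
differentiating the inverse Hessian. -/
lemma gradInner_weightedLaplacian (c : ℝ) (hψ : ContDiff ℝ ∞ ψ)
    (hdet : ∀ x, (hess ψ x).det ≠ 0) (hu : ContDiff ℝ ∞ u) (x : EuclideanSpace ℝ (Fin n)) :
    gradInner ψ u (weightedLaplacian ψ (fun _ => c) u) x =
      (∑ k, ∑ l, (hess ψ x)⁻¹ k l * (pdMat k (hess u) x l ⬝ᵥ riemVec ψ u x)) -
      ((hess ψ x)⁻¹ * thirdContract ψ x (riemVec ψ u x) * (hess ψ x)⁻¹ * hess u x).trace := by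
  have hG := smoothMat_hess_inv hψ hdet
  have hA := smoothMat_hess hu
  have h1 : ∀ i, gradVec (weightedLaplacian ψ (fun _ => c) u) x i =
      ((hess ψ x)⁻¹ * pdMat i (hess u) x).trace -
        ((hess ψ x)⁻¹ * pdMat i (hess ψ) x * (hess ψ x)⁻¹ * hess u x).trace := by
    intro i
    have e : weightedLaplacian ψ (fun _ => c) u = fun y => ((hess ψ y)⁻¹ * hess u y).trace :=
      funext (weightedLaplacian_eq c hu)
    change pd i _ x = _
    rw [e, pd_trace i (hG.mul hA), pdMat_mul i hG hA, pdMat_inv i (smoothMat_hess hψ) hdet,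
      Matrix.trace_add, Matrix.neg_mul, Matrix.trace_neg]
    ring
  rw [gradInner_eq hψ hdet]
  simp only [dotProduct, h1, mul_sub, Finset.sum_sub_distrib]
  congr 1
  · simp only [Matrix.trace, Matrix.diag_apply, Matrix.mul_apply, Finset.mul_sum]
    rw [Finset.sum_comm]
    refine Finset.sum_congr rfl fun k _ => ?_
    rw [Finset.sum_comm]
    refine Finset.sum_congr rfl fun l _ => Finset.sum_congr rfl fun i _ => ?_
    rw [← congrFun (congrFun (pdMat_hess_transpose i hu x) l) k, transpose_apply,
      pdMat_hess_left_comm i k l hu,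
      ← congrFun (congrFun (pdMat_hess_transpose k hu x) i) l, transpose_apply]
    ring
  · rw [thirdContract_eq_sum hψ]
    simp only [Matrix.mul_sum, Matrix.sum_mul, Matrix.trace_sum, Matrix.mul_smul, Matrix.smul_mul,
      Matrix.trace_smul, smul_eq_mul]

/-- Differentiating Jacobi's formula once more expresses the Hessian of `log ρ_ψ`, up to sign and
normalization the Ricci tensor, through the fourth derivatives of `ψ`. It thereby eliminates them
from the Laplacian of `|∇^ψ u|²`. -/
lemma sum_pd_pd_log_rho (hψ : ContDiff ℝ ∞ ψ) (hdet : ∀ x, (hess ψ x).det ≠ 0)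
    (x : EuclideanSpace ℝ (Fin n)) (V : Fin n → ℝ) :
    ∑ a, ∑ b, V a * V b * pd a (pd b fun y => Real.log (rho ψ y)) x =
      (∑ k, ∑ l, (hess ψ x)⁻¹ k l * (V ⬝ᵥ pdMat k (pdMat l (hess ψ)) x *ᵥ V)) -
      ((hess ψ x)⁻¹ * thirdContract ψ x V * (hess ψ x)⁻¹ * thirdContract ψ x V).trace := by
  have hG := smoothMat_hess_inv hψ hdet
  have hH := smoothMat_hess hψ
  have h1 : ∀ a b, pd a (pd b fun y => Real.log (rho ψ y)) x =
      ((hess ψ x)⁻¹ * pdMat a (pdMat b (hess ψ)) x).trace -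
        ((hess ψ x)⁻¹ * pdMat a (hess ψ) x * (hess ψ x)⁻¹ * pdMat b (hess ψ) x).trace := by
    intro a b
    have e : (pd b fun y => Real.log (rho ψ y)) =
        fun y => ((hess ψ y)⁻¹ * pdMat b (hess ψ) y).trace :=
      funext (pd_log_det b hH hdet)
    have hT := smoothMat_pdMat b hH
    rw [e, pd_trace a (hG.mul hT), pdMat_mul a hG hT, pdMat_inv a hH hdet,
      Matrix.trace_add, Matrix.neg_mul, Matrix.trace_neg]
    ring
  simp only [h1, mul_sub, Finset.sum_sub_distrib]
  congr 1
  -- Total symmetry of the fourth derivatives lets the differentiation indices trade places with the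
  -- Hessian indices.
  · have h4 : ∀ a b k l, pdMat a (pdMat b (hess ψ)) x l k = pdMat k (pdMat l (hess ψ)) x a b := by
      intro a b k l
      change pd a (pd b (pd l (pd k ψ))) x = pd k (pd l (pd a (pd b ψ))) x
      rw [pd_comm l k hψ, pd_comm b k (contDiff_pd l hψ),
        pd_comm a k (contDiff_pd b (contDiff_pd l hψ)), pd_comm b l hψ,
        pd_comm a l (contDiff_pd b hψ)]
    simp only [Matrix.trace, Matrix.diag_apply, Matrix.mul_apply, Finset.mul_sum, dotProduct,
      Matrix.mulVec]
    have e1 : ∀ f : Fin n → Fin n → Fin n → Fin n → ℝ,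
        ∑ a, ∑ b, ∑ k, ∑ l, f a b k l = ∑ k, ∑ l, ∑ a, ∑ b, f a b k l := by
      intro f
      simp only [← Finset.sum_product', Finset.univ_product_univ]
      exact Fintype.sum_equiv
        ⟨fun t => (t.2.2.1, t.2.2.2, t.1, t.2.1), fun t => (t.2.2.1, t.2.2.2, t.1, t.2.1),
          fun _ => rfl, fun _ => rfl⟩ _ _ fun _ => rfl
    rw [e1]
    refine Finset.sum_congr rfl fun k _ => Finset.sum_congr rfl fun l _ =>
      Finset.sum_congr rfl fun a _ => Finset.sum_congr rfl fun b _ => by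
        rw [h4 a b k l]; ring
  · rw [thirdContract_eq_sum hψ]
    simp only [Matrix.sum_mul, Matrix.trace_sum, Matrix.mul_smul, Matrix.smul_mul,
      Matrix.trace_smul, smul_eq_mul, Finset.mul_sum]
    rw [Finset.sum_comm]
    exact Finset.sum_congr rfl fun a _ => Finset.sum_congr rfl fun b _ => by ring

/-- Along the line through `x` in direction `V`, a concave function has antitone derivative, and the
sum is its second derivative at zero. -/
lemma sum_pd_pd_nonpos_of_concaveOn {g : EuclideanSpace ℝ (Fin n) → ℝ} (hg : ContDiff ℝ ∞ g)
    (hconc : ConcaveOn ℝ Set.univ g) (x : EuclideanSpace ℝ (Fin n)) (V : Fin n → ℝ) :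
    ∑ a, ∑ b, V a * V b * pd a (pd b g) x ≤ 0 := by
  set W : EuclideanSpace ℝ (Fin n) := WithLp.toLp 2 V
  have hline : ∀ t : ℝ, HasDerivAt (fun t : ℝ => x + t • W) W t := by
    intro t
    simpa using ((hasDerivAt_id t).smul_const W).const_add x
  have hcomp : ∀ f : EuclideanSpace ℝ (Fin n) → ℝ, ContDiff ℝ ∞ f → ∀ t : ℝ,
      HasDerivAt (fun t : ℝ => f (x + t • W)) (∑ b, V b * pd b f (x + t • W)) t := by
    intro f hf t
    have := (differentiableAt_of_smooth (x := x + t • W) hf).hasFDerivAt.comp_hasDerivAt t (hline t)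
    rwa [fderiv_apply_eq_sum_pd] at this
  have h1 : deriv (fun t : ℝ => g (x + t • W)) = fun t => ∑ b, V b * pd b g (x + t • W) :=
    funext fun t => (hcomp g hg t).deriv
  have hanti : Antitone (deriv fun t : ℝ => g (x + t • W)) := by
    have hc : ConcaveOn ℝ Set.univ fun t : ℝ => g (x + t • W) := by
      refine ⟨convex_univ, fun s _ t _ a b ha hb hab => ?_⟩
      have := hconc.2 (Set.mem_univ (x + s • W)) (Set.mem_univ (x + t • W)) ha hb hab
      refine this.trans_eq (congrArg g ?_)
      obtain rfl : b = 1 - a := by linarith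
      simp only [smul_eq_mul]
      module
    exact antitoneOn_univ.1 (hc.antitoneOn_deriv fun t _ => (hcomp g hg t).differentiableAt)
  have hsm : ContDiff ℝ ∞ fun y => ∑ b, V b * pd b g y :=
    ContDiff.sum fun b _ => contDiff_const.mul (contDiff_pd b hg)
  have h2 := hcomp _ hsm 0
  have h3 : deriv (deriv fun t : ℝ => g (x + t • W)) 0 ≤ 0 := hanti.deriv_nonpos
  rw [h1, h2.deriv, zero_smul, add_zero] at h3
  refine le_of_eq_of_le (Finset.sum_congr rfl fun a _ => ?_) h3
  rw [pd_sum _ _ fun b _ => differentiableAt_of_smooth (contDiff_const.mul (contDiff_pd b hg)),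
    Finset.mul_sum]
  refine Finset.sum_congr rfl fun b _ => ?_
  rw [pd_const_mul _ _ (differentiableAt_of_smooth (contDiff_pd b hg))]
  ring

/-- Writing `G = SᴴS`, the trace becomes the squared Hilbert–Schmidt norm of `S P Sᴴ`. -/
lemma trace_mul_mul_mul_nonneg {G P : Matrix (Fin n) (Fin n) ℝ} (hG : G.PosSemidef)
    (hP : Pᵀ = P) : 0 ≤ (G * P * G * P).trace := by
  obtain ⟨S, rfl⟩ : ∃ S, G = Sᴴ * S := by
    open scoped MatrixOrder in exact CStarAlgebra.nonneg_iff_eq_star_mul_self.1 hG.nonneg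
  have h : (Sᴴ * S * P * (Sᴴ * S) * P).trace = ((S * P * Sᴴ)ᴴ * (S * P * Sᴴ)).trace := by
    have e : (S * P * Sᴴ)ᴴ = S * P * Sᴴ := by
      rw [Matrix.conjTranspose_mul, Matrix.conjTranspose_mul, Matrix.conjTranspose_conjTranspose,
        Matrix.conjTranspose_eq_transpose_of_trivial P, hP, mul_assoc]
    rw [e]
    have : Sᴴ * S * P * (Sᴴ * S) * P = Sᴴ * (S * P * Sᴴ * S * P) := by simp only [mul_assoc]
    rw [this, Matrix.trace_mul_comm]
    simp only [mul_assoc]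
  rw [h]
  exact (Matrix.posSemidef_conjTranspose_mul_self _).trace_nonneg

lemma posSemidef_hess (hψ : ContDiff ℝ ∞ ψ) (hconv : ConvexOn ℝ Set.univ ψ)
    (x : EuclideanSpace ℝ (Fin n)) : (hess ψ x).PosSemidef := by
  refine Matrix.PosSemidef.of_dotProduct_mulVec_nonneg ?_ fun V => ?_
  · rw [Matrix.IsHermitian, Matrix.conjTranspose_eq_transpose_of_trivial, hess_transpose hψ]
  · have h := sum_pd_pd_nonpos_of_concaveOn hψ.neg hconv.neg x V
    have e : ∀ a b, pd a (pd b (-ψ)) x = -hess ψ x a b := by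
      intro a b
      have e1 : pd b (-ψ) = -pd b ψ := by funext y; simp [pd, fderiv_neg]
      rw [e1]
      simp [pd, fderiv_neg, hess]
    rw [show (fun i => -ψ i) = -ψ from rfl] at h
    simp only [e, mul_neg, Finset.sum_neg_distrib, neg_nonpos] at h
    simp only [star_trivial, dotProduct, Matrix.mulVec, Finset.mul_sum]
    refine h.trans_eq (Finset.sum_congr rfl fun a _ => Finset.sum_congr rfl fun b _ => by ring)

/-- A consequence of the Bochner identity for the Kähler metric with potential `ψ`, whose Ricci
curvature is nonnegative because `ρ_ψ` is log-concave. -/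
lemma bochner_inequality (c : ℝ) (hψ : ContDiff ℝ ∞ ψ) (hconv : ConvexOn ℝ Set.univ ψ)
    (hdet : ∀ x, (hess ψ x).det ≠ 0)
    (hlog : ConcaveOn ℝ Set.univ fun x => Real.log (rho ψ x))
    (hu : ContDiff ℝ ∞ u) (x : EuclideanSpace ℝ (Fin n)) :
    ((hess ψ x)⁻¹ * thirdContract ψ x (riemVec ψ u x) * (hess ψ x)⁻¹ *
        thirdContract ψ x (riemVec ψ u x)).trace ≤
      2 * (weightedLaplacian ψ (fun _ => c) (gradInner ψ u u) x -
        2 * gradInner ψ u (weightedLaplacian ψ (fun _ => c) u) x) := by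
  have hlogs : ContDiff ℝ ∞ fun x => Real.log (rho ψ x) :=
    (smoothMat_hess hψ).det.log hdet
  have hric := sum_pd_pd_nonpos_of_concaveOn hlogs hlog x (riemVec ψ u x)
  rw [sum_pd_pd_log_rho hψ hdet] at hric
  rw [weightedLaplacian_gradInner_self c hψ hdet hu, gradInner_weightedLaplacian c hψ hdet hu]
  set G := (hess ψ x)⁻¹
  set A := hess u x
  set B := thirdContract ψ x (riemVec ψ u x)
  have hA : Aᵀ = A := hess_transpose hu x
  have hB : Bᵀ = B := thirdContract_transpose hψ x _
  have hG : G.PosSemidef := (posSemidef_hess hψ hconv x).inv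
  -- Completing the square: the bracket on the right of the goal equals `½ tr(G(2A-B)G(2A-B)) + ½
  -- tr(GBGB)` minus the Hessian of `log ρ_ψ` on `∇^ψ u`. The factor 2 in `2A - B` leaves exactly
  -- half of `tr(GBGB)`.
  have hsq : 0 ≤ (G * ((2 : ℝ) • A - B) * G * ((2 : ℝ) • A - B)).trace :=
    trace_mul_mul_mul_nonneg hG (by rw [Matrix.transpose_sub, Matrix.transpose_smul, hA, hB])
  have hcomm : (G * A * G * B).trace = (G * B * G * A).trace := by
    rw [mul_assoc, Matrix.trace_mul_comm, ← mul_assoc]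
  simp only [mul_sub, sub_mul, Matrix.trace_sub, Matrix.mul_smul, Matrix.smul_mul,
    Matrix.trace_smul, smul_eq_mul, hcomm] at hsq ⊢
  linarith

end Bochner

/-! ### The gradient map and the Legendre transform -/

section GradientMap

open Filter Topology

variable {ψ f : EuclideanSpace ℝ (Fin n) → ℝ}

lemma inner_gradient (f : EuclideanSpace ℝ (Fin n) → ℝ) (x v : EuclideanSpace ℝ (Fin n)) :
    inner ℝ (∇ f x) v = fderiv ℝ f x v := by
  rw [← InnerProductSpace.toDual_apply_apply, toDual_gradient]

lemma gradient_apply (f : EuclideanSpace ℝ (Fin n) → ℝ) (x : EuclideanSpace ℝ (Fin n))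
    (i : Fin n) : ∇ f x i = pd i f x := by
  rw [pd, ← inner_gradient, EuclideanSpace.inner_single_right]
  simp

/-- The derivative of the gradient map, as a linear map. -/
def hessLin (ψ : EuclideanSpace ℝ (Fin n) → ℝ) (x : EuclideanSpace ℝ (Fin n)) :
    EuclideanSpace ℝ (Fin n) →L[ℝ] EuclideanSpace ℝ (Fin n) :=
  LinearMap.toContinuousLinearMap (Matrix.toLin (EuclideanSpace.basisFun (Fin n) ℝ).toBasis
    (EuclideanSpace.basisFun (Fin n) ℝ).toBasis (hess ψ x))

lemma det_hessLin (ψ : EuclideanSpace ℝ (Fin n) → ℝ) (x : EuclideanSpace ℝ (Fin n)) :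
    (hessLin ψ x).det = rho ψ x := by
  rw [ContinuousLinearMap.det, hessLin, LinearMap.coe_toContinuousLinearMap, LinearMap.det_toLin,
    rho]

lemma hessLin_apply (ψ : EuclideanSpace ℝ (Fin n) → ℝ) (x v : EuclideanSpace ℝ (Fin n))
    (i : Fin n) : hessLin ψ x v i = ∑ j, hess ψ x i j * v j := by
  rw [hessLin, ← Matrix.toEuclideanLin_eq_toLin_orthonormal]
  rfl

lemma hasStrictFDerivAt_gradient (hψ : ContDiff ℝ ∞ ψ) (x : EuclideanSpace ℝ (Fin n)) :
    HasStrictFDerivAt (∇ ψ) (hessLin ψ x) x := by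
  rw [hasStrictFDerivAt_euclidean]
  intro i
  have h := ((contDiff_pd i hψ).contDiffAt (x := x)).hasStrictFDerivAt (by simp)
  have e : (fun y => ∇ ψ y i) = pd i ψ := funext fun y => gradient_apply ψ y i
  rw [e]
  refine h.congr_fderiv (ContinuousLinearMap.ext fun v => ?_)
  rw [fderiv_apply_eq_sum_pd]
  symm
  refine (hessLin_apply ψ x v i).trans (Finset.sum_congr rfl fun j _ => ?_)
  rw [mul_comm, ← congrFun (pd_comm i j hψ) x]
  rfl

lemma continuous_gradient (hψ : ContDiff ℝ ∞ ψ) : Continuous (∇ ψ) :=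
  continuous_iff_continuousAt.2 fun x => (hasStrictFDerivAt_gradient hψ x).continuousAt

lemma add_inner_gradient_le (hψ : ContDiff ℝ ∞ ψ) (hconv : ConvexOn ℝ Set.univ ψ)
    (y z : EuclideanSpace ℝ (Fin n)) : ψ y + inner ℝ (∇ ψ y) (z - y) ≤ ψ z := by
  have hline : HasDerivAt (fun t : ℝ => y + t • (z - y)) (z - y) 0 := by
    simpa using ((hasDerivAt_id (0 : ℝ)).smul_const (z - y)).const_add y
  have hd : HasDerivAt (fun t : ℝ => ψ (y + t • (z - y))) (inner ℝ (∇ ψ y) (z - y)) 0 := by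
    rw [inner_gradient]
    have h0 : HasFDerivAt ψ (fderiv ℝ ψ y) (y + (0 : ℝ) • (z - y)) := by
      simpa using (differentiableAt_of_smooth (x := y) hψ).hasFDerivAt
    exact h0.comp_hasDerivAt 0 hline
  have hc : ConvexOn ℝ Set.univ fun t : ℝ => ψ (y + t • (z - y)) := by
    refine ⟨convex_univ, fun s _ t _ a b ha hb hab => ?_⟩
    refine (congrArg ψ ?_).trans_le
      (hconv.2 (Set.mem_univ (y + s • (z - y))) (Set.mem_univ (y + t • (z - y))) ha hb hab)
    obtain rfl : b = 1 - a := by linarith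
    simp only [smul_eq_mul]
    module
  have := hc.le_slope_of_hasDerivAt (Set.mem_univ 0) (Set.mem_univ 1) one_pos hd
  simp only [slope_def_field, one_smul, zero_smul, add_zero, sub_zero, div_one,
    add_sub_cancel] at this
  linarith

lemma inner_sub_le_of_gradient (hψ : ContDiff ℝ ∞ ψ) (hconv : ConvexOn ℝ Set.univ ψ)
    (y z : EuclideanSpace ℝ (Fin n)) :
    inner ℝ (∇ ψ y) z - ψ z ≤ inner ℝ (∇ ψ y) y - ψ y := by
  have := add_inner_gradient_le hψ hconv y z
  rw [inner_sub_right] at this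
  linarith

lemma legendre_gradient (hψ : ContDiff ℝ ∞ ψ) (hconv : ConvexOn ℝ Set.univ ψ)
    (y : EuclideanSpace ℝ (Fin n)) :
    legendre ψ (∇ ψ y) = inner ℝ (∇ ψ y) y - ψ y :=
  le_antisymm (ciSup_le fun z => inner_sub_le_of_gradient hψ hconv y z)
    (le_ciSup (f := fun z => inner ℝ (∇ ψ y) z - ψ z)
      ⟨_, Set.forall_mem_range.2 fun z => inner_sub_le_of_gradient hψ hconv y z⟩ y)

lemma le_legendre_gradient (hψ : ContDiff ℝ ∞ ψ) (hconv : ConvexOn ℝ Set.univ ψ)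
    (y z : EuclideanSpace ℝ (Fin n)) :
    inner ℝ (∇ ψ y) z - ψ z ≤ legendre ψ (∇ ψ y) := by
  rw [legendre_gradient hψ hconv]
  exact inner_sub_le_of_gradient hψ hconv y z

/-- Let `x = ∇ψ(z)` be near `ξ = ∇ψ(y)`. Two Fenchel–Young inequalities, with equality at matching
points, trap `ψ*(x) - ψ*(ξ) - ⟨x - ξ, y⟩` between `0` and `⟨x - ξ, z - y⟩`. The inverse function
theorem gives `z → y` as `x → ξ`, so the error is `o(‖x - ξ‖)`. -/
lemma hasGradientAt_legendre (hψ : ContDiff ℝ ∞ ψ) (hconv : ConvexOn ℝ Set.univ ψ)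
    (hdet : ∀ x, (hess ψ x).det ≠ 0) (y : EuclideanSpace ℝ (Fin n)) :
    HasGradientAt (legendre ψ) y (∇ ψ y) := by
  have hD : (hessLin ψ y).det ≠ 0 := by
    rw [det_hessLin]
    exact hdet y
  have hs : HasStrictFDerivAt (∇ ψ)
      (((hessLin ψ y).toContinuousLinearEquivOfDetNeZero hD :
        EuclideanSpace ℝ (Fin n) ≃L[ℝ] EuclideanSpace ℝ (Fin n)) :
        EuclideanSpace ℝ (Fin n) →L[ℝ] EuclideanSpace ℝ (Fin n)) y := by
    rw [ContinuousLinearMap.coe_toContinuousLinearEquivOfDetNeZero]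
    exact hasStrictFDerivAt_gradient hψ y
  set g := hs.localInverse
  have hright : ∀ᶠ x in 𝓝 (∇ ψ y), ∇ ψ (g x) = x := hs.eventually_right_inverse
  have hgt : Tendsto g (𝓝 (∇ ψ y)) (𝓝 y) := hs.localInverse_tendsto
  rw [hasGradientAt_iff_isLittleO, Asymptotics.isLittleO_iff]
  intro c hc
  filter_upwards [hright, hgt.eventually (Metric.closedBall_mem_nhds y hc)] with x hx hxc
  have h1 := le_legendre_gradient hψ hconv (g x) y
  have h2 := le_legendre_gradient hψ hconv y (g x)
  have h3 := legendre_gradient hψ hconv (g x)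
  have h4 := legendre_gradient hψ hconv y
  rw [hx] at h1 h3
  have h5 : inner ℝ (x - ∇ ψ y) (g x - y) ≤ c * ‖x - ∇ ψ y‖ := by
    refine (real_inner_le_norm _ _).trans ?_
    rw [mul_comm]
    rw [dist_eq_norm] at hxc
    gcongr
  rw [real_inner_comm, Real.norm_eq_abs, abs_le]
  simp only [inner_sub_left, inner_sub_right] at h5 ⊢
  have h6 : 0 ≤ c * ‖x - ∇ ψ y‖ := by positivity
  constructor <;> linarith

lemma gradient_legendre_gradient (hψ : ContDiff ℝ ∞ ψ) (hconv : ConvexOn ℝ Set.univ ψ)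
    (hdet : ∀ x, (hess ψ x).det ≠ 0) (y : EuclideanSpace ℝ (Fin n)) :
    ∇ (legendre ψ) (∇ ψ y) = y :=
  (hasGradientAt_legendre hψ hconv hdet y).gradient

lemma measurableEmbedding_gradient (hψ : ContDiff ℝ ∞ ψ) (hconv : ConvexOn ℝ Set.univ ψ)
    (hdet : ∀ x, (hess ψ x).det ≠ 0) : MeasurableEmbedding (∇ ψ) :=
  (continuous_gradient hψ).measurableEmbedding
    (Function.LeftInverse.injective (gradient_legendre_gradient hψ hconv hdet))

/-- Change of variables: the Jacobian of the injective map `∇ψ` is `ρ_ψ`, the density of the measure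
up to `e^{-c}`. -/
lemma map_gradient_weightedMeasure (c : ℝ) (hψ : ContDiff ℝ ∞ ψ)
    (hconv : ConvexOn ℝ Set.univ ψ) (hpos : ∀ x, 0 < rho ψ x) :
    (weightedMeasure ψ fun _ => c).map (∇ ψ) =
      ENNReal.ofReal (Real.exp (-c)) • volume.restrict (Set.range (∇ ψ)) := by
  have hdet : ∀ x, (hess ψ x).det ≠ 0 := fun x => (hpos x).ne'
  have h1 := map_withDensity_abs_det_fderiv_eq_addHaar (s := Set.univ) (f := ∇ ψ)
    (f' := hessLin ψ) (volume : Measure (EuclideanSpace ℝ (Fin n))) nullMeasurableSet_univ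
    (fun x _ => (hasStrictFDerivAt_gradient hψ x).hasFDerivAt.hasFDerivWithinAt)
    (measurableEmbedding_gradient hψ hconv hdet).injective.injOn
  simp only [Measure.restrict_univ, Set.image_univ, det_hessLin, abs_of_pos (hpos _)] at h1
  have h2 : weightedMeasure ψ (fun _ => c) = ENNReal.ofReal (Real.exp (-c)) •
      volume.withDensity fun x => ENNReal.ofReal (rho ψ x) := by
    rw [weightedMeasure, ← withDensity_smul' _ _ ENNReal.ofReal_ne_top]
    congr 1
    funext x
    rw [ENNReal.ofReal_mul (Real.exp_pos _).le]
    rfl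
  rw [h2, Measure.map_smul, h1]

end GradientMap

/-! ### The quadratic forms -/

section QuadraticForms

open Matrix

variable {ψ : EuclideanSpace ℝ (Fin n) → ℝ}

lemma Qstar_smul (ψ : EuclideanSpace ℝ (Fin n) → ℝ) (x V : EuclideanSpace ℝ (Fin n)) (s : ℝ) :
    Qstar ψ x (s • V) = s ^ 2 * Qstar ψ x V := by
  simp only [Qstar, Finset.mul_sum, PiLp.smul_apply, smul_eq_mul]
  refine Finset.sum_congr rfl fun i _ => Finset.sum_congr rfl fun j _ =>
    Finset.sum_congr rfl fun k _ => Finset.sum_congr rfl fun l _ =>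
    Finset.sum_congr rfl fun m _ => Finset.sum_congr rfl fun p _ => by ring

lemma metric_smul_right (ψ : EuclideanSpace ℝ (Fin n) → ℝ) (y U V : EuclideanSpace ℝ (Fin n))
    (s : ℝ) : metric ψ y U (s • V) = s * metric ψ y U V := by
  simp only [metric, Finset.mul_sum, PiLp.smul_apply, smul_eq_mul]
  exact Finset.sum_congr rfl fun i _ => Finset.sum_congr rfl fun j _ => by ring

lemma Qstar_nonneg (hψ : ContDiff ℝ ∞ ψ) (hconv : ConvexOn ℝ Set.univ ψ)
    (x V : EuclideanSpace ℝ (Fin n)) : 0 ≤ Qstar ψ x V := by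
  rw [Qstar_eq hψ]
  exact trace_mul_mul_mul_nonneg (posSemidef_hess hψ hconv _).inv (thirdContract_transpose hψ _ _)

lemma ofReal_sq_le_Q (x U V : EuclideanSpace ℝ (Fin n)) (s : ℝ)
    (hs : s ^ 2 * Qstar ψ x V ≤ 1) :
    ENNReal.ofReal (4 * (s * metric ψ (∇ (legendre ψ) x) U V) ^ 2) ≤ Q ψ x U := by
  rw [← metric_smul_right]
  rw [← Qstar_smul] at hs
  exact le_iSup₂ (f := fun (W : EuclideanSpace ℝ (Fin n)) (_ : Qstar ψ x W ≤ 1) =>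
    ENNReal.ofReal (4 * (metric ψ (∇ (legendre ψ) x) U W) ^ 2)) (s • V) hs

/-- The Cauchy–Schwarz inequality between the dual forms `Q` and `Q^*`, in additive form. -/
lemma two_mul_abs_metric_le (hψ : ContDiff ℝ ∞ ψ) (hconv : ConvexOn ℝ Set.univ ψ)
    (x U V : EuclideanSpace ℝ (Fin n)) :
    ENNReal.ofReal (2 * |metric ψ (∇ (legendre ψ) x) U V|) ≤
      Q ψ x U + ENNReal.ofReal (Qstar ψ x V / 4) := by
  set m := metric ψ (∇ (legendre ψ) x) U V
  rcases (Qstar_nonneg hψ hconv x V).eq_or_lt with ha | ha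
  · refine le_add_right ?_
    rcases eq_or_ne m 0 with hm | hm
    · simp [hm]
    have hm' : 0 < |m| := abs_pos.2 hm
    -- When `Q^*(V) = 0` every multiple of `V` is admissible; this scaling makes `4 (s m)²` equal to
    -- `2|m|`.
    refine le_trans (le_of_eq ?_) (ofReal_sq_le_Q x U V (√(2 * |m|))⁻¹ (by simp [← ha]))
    congr 1
    rw [mul_pow, inv_pow, Real.sq_sqrt (by positivity), ← sq_abs m]
    field_simp
    norm_num
  · set a := Qstar ψ x V
    have hr := Real.sq_sqrt ha.le
    have hr0 : 0 < √a := Real.sqrt_pos.2 ha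
    -- Normalizing `V` gives `Q ≥ 4m²/a`; the claim is then `2pq ≤ p² + q²` with `p = 2|m|/√a` and
    -- `q = √a/2`.
    have hQ := ofReal_sq_le_Q x U V (√a)⁻¹ (by rw [inv_pow, hr, inv_mul_cancel₀ ha.ne'])
    refine le_trans ?_ (add_le_add_left hQ _)
    rw [← ENNReal.ofReal_add (by positivity) (by positivity)]
    refine ENNReal.ofReal_le_ofReal ?_
    have h1 : 2 * |m| = 2 * (2 * ((√a)⁻¹ * |m|)) * (√a / 2) := by field_simp
    have h2 : 4 * ((√a)⁻¹ * m) ^ 2 + a / 4 = (2 * ((√a)⁻¹ * |m|)) ^ 2 + (√a / 2) ^ 2 := by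
      rw [div_pow, hr, mul_pow, mul_pow, mul_pow, sq_abs]
      norm_num
    change 2 * |m| ≤ 4 * ((√a)⁻¹ * m) ^ 2 + a / 4
    rw [h1, h2]
    exact two_mul_le_add_sq _ _

end QuadraticForms

/-! ### The Poincaré inequality -/

section Poincare

open Filter Topology

variable {ψ u f : EuclideanSpace ℝ (Fin n) → ℝ}

lemma IsRegularitySpace.integrable_sq_weightedLaplacian {φ : EuclideanSpace ℝ (Fin n) → ℝ}
    {X : Submodule ℝ (EuclideanSpace ℝ (Fin n) → ℝ)} (hX : IsRegularitySpace ψ φ X) (hu : u ∈ X) :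
    Integrable (fun x => weightedLaplacian ψ φ u x ^ 2) (weightedMeasure ψ φ) := by
  simpa only [sq] using (hX.parts u hu _ (hX.laplacian_mem u hu)).1

lemma IsRegularitySpace.memLp_weightedLaplacian {φ : EuclideanSpace ℝ (Fin n) → ℝ}
    {X : Submodule ℝ (EuclideanSpace ℝ (Fin n) → ℝ)} (hX : IsRegularitySpace ψ φ X) (hu : u ∈ X) :
    MemLp (weightedLaplacian ψ φ u) 2 (weightedMeasure ψ φ) :=
  (memLp_two_iff_integrable_sq
    (hX.smooth _ (hX.laplacian_mem u hu)).continuous.aestronglyMeasurable).2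
    (hX.integrable_sq_weightedLaplacian hu)

/-- The integral of the right-hand side of the Bochner inequality. -/
lemma IsRegularitySpace.integral_bochner {c : ℝ}
    {X : Submodule ℝ (EuclideanSpace ℝ (Fin n) → ℝ)}
    (hX : IsRegularitySpace ψ (fun _ => c) X) (hψ : ContDiff ℝ ∞ ψ)
    (hdet : ∀ x, (hess ψ x).det ≠ 0) (hu : u ∈ X) :
    Integrable (fun x => weightedLaplacian ψ (fun _ => c) (gradInner ψ u u) x -
      2 * gradInner ψ u (weightedLaplacian ψ (fun _ => c) u) x)
      (weightedMeasure ψ fun _ => c) ∧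
    ∫ x, (weightedLaplacian ψ (fun _ => c) (gradInner ψ u u) x -
      2 * gradInner ψ u (weightedLaplacian ψ (fun _ => c) u) x)
      ∂(weightedMeasure ψ fun _ => c) =
      2 * ∫ x, weightedLaplacian ψ (fun _ => c) u x ^ 2 ∂(weightedMeasure ψ fun _ => c) := by
  -- Testing `L|∇^ψ u|²` against `1` gives integral zero; testing `Lu` against itself gives `∫ ⟨∇^ψ
  -- u, ∇^ψ Lu⟩ = -∫ (Lu)²`.
  obtain ⟨h1, -, h3⟩ := hX.parts _ (hX.normSq_mem u hu) _ (hX.const_mem 1)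
  obtain ⟨-, h5, h6⟩ := hX.parts u hu _ (hX.laplacian_mem u hu)
  have h0 : ∀ x, gradInner ψ (gradInner ψ u u) (fun _ => (1 : ℝ)) x = 0 := by
    intro x
    have hz : gradVec (fun _ : EuclideanSpace ℝ (Fin n) => (1 : ℝ)) x = 0 := by
      funext i
      simp [gradVec, pd_const]
    rw [gradInner_eq hψ hdet, hz, dotProduct_zero]
  simp only [one_mul, h0, integral_zero, neg_zero] at h1 h3
  refine ⟨h1.sub (h5.const_mul 2), ?_⟩
  rw [integral_sub h1 (h5.const_mul 2), integral_const_mul, h3]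
  simp only [sq]
  linarith

lemma gradVec_comp_gradient (hψ : ContDiff ℝ ∞ ψ) {y : EuclideanSpace ℝ (Fin n)}
    (hf : DifferentiableAt ℝ f (∇ ψ y)) :
    gradVec (fun z => f (∇ ψ z)) y = Matrix.mulVec (hess ψ y) (∇ f (∇ ψ y)).ofLp := by
  have h := hf.hasFDerivAt.comp y (hasStrictFDerivAt_gradient hψ y).hasFDerivAt
  funext i
  have h1 : gradVec (fun z => f (∇ ψ z)) y i =
      fderiv ℝ f (∇ ψ y) (hessLin ψ y (EuclideanSpace.single i 1)) := by
    change fderiv ℝ (f ∘ ∇ ψ) y _ = _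
    rw [h.fderiv]
    rfl
  rw [h1, fderiv_apply_eq_sum_pd]
  refine Finset.sum_congr rfl fun j _ => ?_
  rw [hessLin_apply, ← gradient_apply]
  congr 1
  simp only [PiLp.single_apply, mul_ite, mul_one, mul_zero, Finset.sum_ite_eq', Finset.mem_univ,
    if_true]
  exact congrFun (pd_comm j i hψ) y

/-- The differential of `f ∘ ∇ψ` is `∇²ψ · ∇f`, so raising its index with `(∇²ψ)⁻¹` returns the
Euclidean gradient `∇f` at `∇ψ(y)`. -/
lemma gradInner_comp_gradient (hψ : ContDiff ℝ ∞ ψ) (hdet : ∀ x, (hess ψ x).det ≠ 0)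
    (u : EuclideanSpace ℝ (Fin n) → ℝ) {y : EuclideanSpace ℝ (Fin n)}
    (hf : DifferentiableAt ℝ f (∇ ψ y)) :
    gradInner ψ u (fun z => f (∇ ψ z)) y = metric ψ y (∇ f (∇ ψ y)) (riemGrad ψ u y) := by
  rw [gradInner_eq hψ hdet, gradVec_comp_gradient hψ hf, metric_eq, riemGrad_eq hψ,
    dotProduct_mulVec_comm (hess_transpose hψ y)]

lemma two_mul_abs_gradInner_le (c : ℝ) (hψ : ContDiff ℝ ∞ ψ) (hconv : ConvexOn ℝ Set.univ ψ)
    (hdet : ∀ x, (hess ψ x).det ≠ 0)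
    (hlog : ConcaveOn ℝ Set.univ fun x => Real.log (rho ψ x)) (hu : ContDiff ℝ ∞ u)
    {y : EuclideanSpace ℝ (Fin n)} (hf : DifferentiableAt ℝ f (∇ ψ y)) :
    ENNReal.ofReal (2 * |gradInner ψ u (fun z => f (∇ ψ z)) y|) ≤
      Q ψ (∇ ψ y) (∇ f (∇ ψ y)) +
        ENNReal.ofReal ((weightedLaplacian ψ (fun _ => c) (gradInner ψ u u) y -
          2 * gradInner ψ u (weightedLaplacian ψ (fun _ => c) u) y) / 2) := by
  have h1 := two_mul_abs_metric_le hψ hconv (∇ ψ y) (∇ f (∇ ψ y)) (riemGrad ψ u y)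
  have h2 := bochner_inequality c hψ hconv hdet hlog hu y
  have h3 := Qstar_eq hψ (∇ ψ y) (riemGrad ψ u y)
  rw [gradient_legendre_gradient hψ hconv hdet] at h1 h3
  rw [gradInner_comp_gradient hψ hdet u hf]
  refine h1.trans (add_le_add_right (ENNReal.ofReal_le_ofReal ?_) _)
  rw [h3, riemGrad_eq hψ]
  linarith

lemma integral_sq_le_of_eLpNorm_lt {α : Type*} [MeasurableSpace α] {μ : Measure α} {g : α → ℝ}
    (hg : MemLp g 2 μ) {δ : ℝ} (hδ : 0 ≤ δ) (h : eLpNorm g 2 μ < ENNReal.ofReal δ) :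
    ∫ x, g x ^ 2 ∂μ ≤ δ ^ 2 := by
  rw [hg.eLpNorm_eq_integral_rpow_norm (by norm_num) (by norm_num)] at h
  have h1 := ((ENNReal.ofReal_lt_ofReal_iff_of_nonneg (by positivity)).1 h).le
  simp only [ENNReal.toReal_ofNat, Real.rpow_two, Real.norm_eq_abs, sq_abs] at h1
  rw [show (2 : ℝ)⁻¹ = 1 / 2 by norm_num, ← Real.sqrt_eq_rpow] at h1
  exact (Real.sqrt_le_left hδ).1 h1

end Poincare

end MomentMap

end

open MomentMap in
theorem theorem1p4 (n : ℕ) (K : Set (EuclideanSpace ℝ (Fin n)))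
    (hK : MomentMap.IsConvexBody K)
    (ψ : EuclideanSpace ℝ (Fin n) → ℝ)
    (hψ : MomentMap.InducesLogConcaveTransportation ψ K)
    (hreg : MomentMap.RegularAtInfinity ψ)
    (f : EuclideanSpace ℝ (Fin n) → ℝ) (hf : ∃ C : ℝ≥0, LipschitzOnWith C f K)
    (hf0 : ∫ x in K, f x = 0) :
    ∫⁻ x in K, ENNReal.ofReal (f x ^ 2) ≤ ∫⁻ x in K, MomentMap.Q ψ x (∇ f x) := by
  obtain ⟨X, hX⟩ := hreg
  obtain ⟨C, hC⟩ := hf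
  have hs := hψ.smooth
  have hconv := hψ.convex
  have hdet : ∀ x, (hess ψ x).det ≠ 0 := fun x => (hψ.rho_pos x).ne'
  have hemb := measurableEmbedding_gradient hs hconv hdet
  have hmap := map_gradient_weightedMeasure 1 hs hconv hψ.rho_pos
  have hgrad := gradient_legendre_gradient hs hconv hdet
  have hrange := hψ.range_gradient
  have hmem : ∀ y, ∇ ψ y ∈ K := fun y => hrange ▸ Set.mem_range_self y
  rw [hrange] at hmap
  set μ := weightedMeasure ψ fun _ => (1 : ℝ)
  set c := ENNReal.ofReal (Real.exp (-1))
  have hc0 : c ≠ 0 := (ENNReal.ofReal_pos.2 (Real.exp_pos _)).ne'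
  have hct : c ≠ ⊤ := ENNReal.ofReal_ne_top
  have hlint : ∀ F : EuclideanSpace ℝ (Fin n) → ℝ≥0∞,
      ∫⁻ y, F (∇ ψ y) ∂μ = c * ∫⁻ x in K, F x := by
    intro F
    rw [← hemb.lintegral_map, hmap, lintegral_smul_measure, smul_eq_mul]
  rw [← ENNReal.mul_le_mul_iff_right hc0 hct, ← hlint, ← hlint]
  have hfin : IsFiniteMeasure μ := by
    refine ⟨?_⟩
    have h1 := hlint fun _ => 1
    simp only [lintegral_const, one_mul, Measure.restrict_apply_univ] at h1
    rw [h1]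
    exact ENNReal.mul_lt_top hct.lt_top hK.bounded.measure_lt_top
  -- The function `f ∘ ∇ψ` is bounded, continuous and of integral zero.
  set h : EuclideanSpace ℝ (Fin n) → ℝ := fun y => f (∇ ψ y) with hh
  have hcont : Continuous h :=
    hC.continuousOn.comp_continuous (continuous_gradient hs) hmem
  obtain ⟨M, hM⟩ : ∃ M, ∀ y, ‖h y‖ ≤ M := by
    obtain ⟨D, hD⟩ := (Metric.isBounded_iff.1 hK.bounded)
    refine ⟨‖h 0‖ + C * D, fun y => ?_⟩
    have h1 := hC.dist_le_mul _ (hmem y) _ (hmem 0)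
    have h2 : (C : ℝ) * dist (∇ ψ y) (∇ ψ 0) ≤ C * D :=
      mul_le_mul_of_nonneg_left (hD (hmem y) (hmem 0)) C.coe_nonneg
    have h3 := norm_le_norm_add_norm_sub' (h y) (h 0)
    rw [← dist_eq_norm] at h3
    exact h3.trans (add_le_add le_rfl (h1.trans h2))
  have hL2 : MemLp h 2 μ :=
    MemLp.of_bound hcont.aestronglyMeasurable M (.of_forall hM)
  have hint : ∫ y, h y ∂μ = 0 := by
    rw [hh, ← hemb.integral_map, hmap, integral_smul_measure, hf0, smul_zero]
  have hlip : ∃ C : ℝ≥0, LipschitzOnWith C (fun x => h (∇ (legendre ψ) x)) (Set.range (∇ ψ)) := by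
    refine ⟨C, fun x hx y hy => ?_⟩
    obtain ⟨x, rfl⟩ := hx
    obtain ⟨y, rfl⟩ := hy
    simpa only [hgrad, hh] using hC (hmem x) (hmem y)
  -- Rademacher's theorem on the open set `K`, pulled back through `∇ψ`.
  have hdiff : ∀ᵐ y ∂μ, DifferentiableAt ℝ f (∇ ψ y) := by
    refine ae_of_ae_map hemb.measurable.aemeasurable ?_
    rw [hmap]
    refine Measure.ae_smul_measure ?_ c
    filter_upwards [hC.ae_differentiableWithinAt hK.isOpen.measurableSet,
      ae_restrict_mem hK.isOpen.measurableSet] with x hx hxK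
    exact hx.differentiableAt (hK.isOpen.mem_nhds hxK)
  set I := ∫⁻ y, Q ψ (∇ ψ y) (∇ f (∇ ψ y)) ∂μ
  rcases eq_or_ne I ⊤ with hIt | hIt
  · rw [hIt]
    exact le_top
  have hkey : ∀ u ∈ X, 2 * ∫ y, h y * weightedLaplacian ψ (fun _ => 1) u y ∂μ ≤
      I.toReal + ∫ y, weightedLaplacian ψ (fun _ => 1) u y ^ 2 ∂μ := by
    intro u hu
    obtain ⟨-, h2, h3⟩ := hX.parts_lipschitz u hu h hlip
    obtain ⟨h4, h5⟩ := hX.integral_bochner hs hdet hu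
    have hsq : 0 ≤ ∫ y, weightedLaplacian ψ (fun _ => 1) u y ^ 2 ∂μ :=
      integral_nonneg fun _ => sq_nonneg _
    have h6 : ENNReal.ofReal (∫ y, 2 * |gradInner ψ u h y| ∂μ) ≤
        I + ENNReal.ofReal (∫ y, weightedLaplacian ψ (fun _ => 1) u y ^ 2 ∂μ) := by
      rw [ofReal_integral_eq_lintegral_ofReal (h2.abs.const_mul 2)
        (.of_forall fun _ => by positivity)]
      refine (lintegral_mono_ae (hdiff.mono fun y hy => two_mul_abs_gradInner_le 1 hs hconv hdet
        hψ.rho_logConcave (hX.smooth u hu) hy)).trans ?_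
      have h7 : ∫ y, weightedLaplacian ψ (fun _ => 1) u y ^ 2 ∂μ =
          ∫ y, (weightedLaplacian ψ (fun _ => 1) (gradInner ψ u u) y -
            2 * gradInner ψ u (weightedLaplacian ψ (fun _ => 1) u) y) / 2 ∂μ := by
        rw [integral_div, h5]
        ring
      rw [lintegral_add_right' _ (h4.div_const 2).aestronglyMeasurable.aemeasurable.ennreal_ofReal,
        h7, ofReal_integral_eq_lintegral_ofReal (h4.div_const 2) (.of_forall fun y => ?_)]
      -- The Bochner bracket is nonnegative, since it dominates half of the nonnegative form `Q^*`;
      -- hence its integral and lower integral agree.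
      have h8 := bochner_inequality 1 hs hconv hdet hψ.rho_logConcave (hX.smooth u hu) y
      have h9 := trace_mul_mul_mul_nonneg (posSemidef_hess hs hconv y).inv
        (thirdContract_transpose hs y (riemVec ψ u y))
      change 0 ≤ _ / (2 : ℝ)
      linarith
    rw [← ENNReal.ofReal_toReal hIt, ← ENNReal.ofReal_add ENNReal.toReal_nonneg hsq,
      ENNReal.ofReal_le_ofReal_iff (add_nonneg ENNReal.toReal_nonneg hsq), integral_const_mul]
      at h6
    rw [h3]
    have h10 := abs_integral_le_integral_abs (f := gradInner ψ u h) (μ := μ)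
    have h11 := neg_le_abs (∫ y, gradInner ψ u h y ∂μ)
    linarith
  have hsqint : Integrable (fun y => h y ^ 2) μ := hL2.integrable_sq
  have hfinal : ∫ y, h y ^ 2 ∂μ ≤ I.toReal := by
    have hδ : ∀ δ : ℝ, 0 < δ → ∫ y, h y ^ 2 ∂μ ≤ I.toReal + δ ^ 2 := by
      intro δ hδ
      -- Approximately solve `Lu = h`, then expand the square of the error; the terms in `Lu` are
      -- absorbed by `hkey`.
      obtain ⟨u, hu, hlt⟩ := hX.dense h hL2 hint (ENNReal.ofReal δ) (ENNReal.ofReal_pos.2 hδ)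
      have hu2 := hX.memLp_weightedLaplacian hu
      have h1 := integral_sq_le_of_eLpNorm_lt (hL2.sub hu2) hδ.le hlt
      have h2 := (hX.parts_lipschitz u hu h hlip).1
      have h3 := hX.integrable_sq_weightedLaplacian hu
      have h4 : ∫ y, (h - weightedLaplacian ψ (fun _ => 1) u) y ^ 2 ∂μ =
          ∫ y, h y ^ 2 ∂μ - 2 * ∫ y, h y * weightedLaplacian ψ (fun _ => 1) u y ∂μ +
            ∫ y, weightedLaplacian ψ (fun _ => 1) u y ^ 2 ∂μ := by
        have hsub : Integrable
            (fun y => h y ^ 2 - 2 * (h y * weightedLaplacian ψ (fun _ => 1) u y)) μ :=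
          hsqint.sub (h2.const_mul 2)
        rw [← integral_const_mul, ← integral_sub hsqint (h2.const_mul 2), ← integral_add hsub h3]
        refine integral_congr_ae (.of_forall fun y => ?_)
        simp only [Pi.sub_apply]
        ring
      have h5 := hkey u hu
      linarith
    refine le_of_forall_pos_le_add fun ε hε => ?_
    have := hδ (√ε) (Real.sqrt_pos.2 hε)
    rwa [Real.sq_sqrt hε.le] at this
  change ∫⁻ y, ENNReal.ofReal (h y ^ 2) ∂μ ≤ I
  rw [← ofReal_integral_eq_lintegral_ofReal hsqint (.of_forall fun _ => sq_nonneg _)]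
  exact (ENNReal.ofReal_le_iff_le_toReal hIt).2 hfinal
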